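/- Let $K$ be a field of characteristic $0$ (e.g. $\mathbb{R}$ or $\mathbb{C}$) and $\alpha\in K$. Let $L_n^{(a)}$ be the classical Laguerre polynomials, defined by $L_0^{(a)}=1$, $L_1^{(a)}(x)=-x+a+1$ and $L_n^{(a)}(x)=\left(2+\frac{-x+a-1}{n}\right)L_{n-1}^{(a)}(x)-\left(1+\frac{a-1}{n}\right)L_{n-2}^{(a)}(x)$ for $n\ge 2$, and put $l_n^{(\alpha)}(x)=n!\,L_n^{(\alpha-n)}(-x)$. For a partition $\lambda=(\lambda_1\ge\dots\ge\lambda_r>0)$ of size $|\lambda|=\sum_i\lambda_i$ let $n_i=\lambda_i+r-i$ ($1\le i\le r$), and define the Wronskian Laguerre polynomial $$l_\lambda^{(\alpha)}=\frac{\mathrm{Wr}[l_{n_1}^{(\alpha)},\dots,l_{n_r}^{(\alpha)}]}{\prod_{i<j}(n_j-n_i)},$$ so that $l_\emptyset^{(\alpha)}=1$. Identify partitions with their Young diagrams. Write $\mu\lessdot\lambda$ if $\mu$ is obtained from $\lambda$ by removing exactly one box; if that box lies in row $i$, let $c(\lambda/\mu)=\lambda_i-i$ be its content. Let $F_\lambda$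 be the number of directed paths $\emptyset\lessdot\dots\lessdot\lambda$ in the Young lattice, i.e. the number of standard Young tableaux of shape $\lambda$. Let $\mathcal{R}_2^-(\lambda)$ be the set of partitions $\rho\le\lambda$ such that $\lambda/\rho$ is a border strip of size $2$ (connected, containing no $2\times2$ square; that is, a domino), and let $\mathrm{ht}(\lambda/\rho)$ be the number of rows that $\lambda/\rho$ meets, minus $1$. **Theorem.** For every non-empty partition $\lambda$, as polynomials in $x$ over $K$, $$F_\lambda\, l_\lambda^{(\alpha)}(x)=\sum_{\mu\lessdot\lambda}\bigl(x+\alpha-c(\lambda/\mu)\bigr)F_\mu\, l_\mu^{(\alpha)}(x)+x\,(|\lambda|-1)\sum_{\rho\in\mathcal{R}_2^-(\lambda)}(-1)^{\mathrm{ht}(\lambda/\rho)}F_\rho\, l_\rho^{(\alpha)}(x).$$ Moreover, for $\lambda=(n)$ with $n\ge 2$, the left-hand side equals $l_n^{(\alpha)}(x)$, the first term on the right equals $(x+\alpha-n+1)\,l_{n-1}^{(\alpha)}(x)$ and the second equals $x(n-1)\,l_{n-2}^{(\alpha)}(x)$, so that the identity becomes the three-term recurrence $l_n^{(\alpha)}(x)=(x+\alpha-n+1)\,l_{n-1}^{(\alpha)}(x)+x(n-1)\,l_{n-2}^{(\alpha)}(x)$.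 -/

import Mathlib

open Polynomial

namespace WronskianLaguerre

/-! ### Laguerre polynomials -/

section Laguerre

variable {K : Type*} [Field K]

/-- The classical Laguerre polynomials `L_n^{(a)}`, given by
`L_n = (2 + (-x + a - 1) / n) L_{n-1} - (1 + (a - 1) / n) L_{n-2}` for `n ≥ 2`. -/
noncomputable def laguerre (a : K) : ℕ → K[X]
  | 0 => 1
  | 1 => -X + C (a + 1)
  | n + 2 =>
      (2 + C (((n + 2 : ℕ) : K)⁻¹) * (-X + C (a - 1))) * laguerre a (n + 1)
        - C (1 + (a - 1) / ((n + 2 : ℕ) : K)) * laguerre a n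

/-- The modified Laguerre polynomials `l_n^{(a)}(x) = n! L_n^{(a - n)}(-x)`. -/
noncomputable def modifiedLaguerre (a : K) (n : ℕ) : K[X] :=
  (n.factorial : K[X]) * (laguerre (a - (n : K)) n).comp (-X)

/-- The Wronskian `Wr[f_1, …, f_r]` of finitely many polynomials. -/
noncomputable def wronskianDet {r : ℕ} (f : Fin r → K[X]) : K[X] :=
  Matrix.det (Matrix.of fun i j : Fin r => derivative^[(i : ℕ)] (f j))

end Laguerre

/-! ### Partitions

A partition is identified with its Young diagram; rows and columns are counted from `0`, so
`lam.rowLen i` is the part with index `i + 1`, `lam.colLen 0` is the number of parts and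
`lam.card` is the size. -/

/-- The degree vector: with `r` the number of parts, `n_i = lam_i + r - i` for `i = 1, …, r`. -/
def degreeVector (lam : YoungDiagram) (i : Fin (lam.colLen 0)) : ℕ :=
  lam.rowLen i + (lam.colLen 0 - ((i : ℕ) + 1))

/-- The boxes of the skew shape `lam / μ`. -/
def skewCells (lam μ : YoungDiagram) : Finset (ℕ × ℕ) :=
  lam.cells \ μ.cells

/-- `μ ⋖ lam`: the diagram `μ` arises from `lam` by removing exactly one box. -/
def IsBoxRemoval (μ lam : YoungDiagram) : Prop :=
  μ ≤ lam ∧ lam.card = μ.card + 1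

/-- A set of boxes is a border strip if it is connected (through common sides of boxes; the
edges of the Hasse graph of `ℕ × ℕ` join exactly the boxes that share a side), in particular
non-empty, and contains no `2 × 2` square. -/
def IsBorderStrip (s : Finset (ℕ × ℕ)) : Prop :=
  ((SimpleGraph.hasse (ℕ × ℕ)).induce (s : Set (ℕ × ℕ))).Connected ∧
    ∀ i j : ℕ, ¬ ((i, j) ∈ s ∧ (i, j + 1) ∈ s ∧ (i + 1, j) ∈ s ∧ (i + 1, j + 1) ∈ s)

/-- `lam / ρ` is a border strip with `k` boxes. -/
def IsBorderStripRemoval (k : ℕ) (ρ lam : YoungDiagram) : Prop :=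
  ρ ≤ lam ∧ IsBorderStrip (skewCells lam ρ) ∧ (skewCells lam ρ).card = k

theorem finite_le (lam : YoungDiagram) : {μ : YoungDiagram | μ ≤ lam}.Finite := by
  refine Set.Finite.of_finite_image (f := YoungDiagram.cells)
    ((lam.cells.powerset).finite_toSet.subset ?_) ?_
  · rintro _ ⟨μ, hμ, rfl⟩
    simpa using YoungDiagram.cells_subset_iff.2 hμ
  · intro μ _ ν _ h
    exact YoungDiagram.ext h

theorem finite_isBoxRemoval (lam : YoungDiagram) : {μ | IsBoxRemoval μ lam}.Finite :=
  (finite_le lam).subset fun _ h => h.1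

theorem finite_isBorderStripRemoval (k : ℕ) (lam : YoungDiagram) :
    {ρ | IsBorderStripRemoval k ρ lam}.Finite :=
  (finite_le lam).subset fun _ h => h.1

/-- The finite set of all `μ ⋖ lam`. -/
noncomputable def boxRemovals (lam : YoungDiagram) : Finset YoungDiagram :=
  (finite_isBoxRemoval lam).toFinset

/-- The finite set `R_k^-(lam)` of all `ρ ≤ lam` such that `lam / ρ` is a border strip of
size `k`. -/
noncomputable def borderStripRemovals (k : ℕ) (lam : YoungDiagram) : Finset YoungDiagram :=
  (finite_isBorderStripRemoval k lam).toFinset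

theorem mem_boxRemovals {μ lam : YoungDiagram} : μ ∈ boxRemovals lam ↔ IsBoxRemoval μ lam := by
  simp [boxRemovals]

theorem mem_borderStripRemovals {k : ℕ} {ρ lam : YoungDiagram} :
    ρ ∈ borderStripRemovals k lam ↔ IsBorderStripRemoval k ρ lam := by
  simp [borderStripRemovals]

/-- The height of `lam / ρ`: the number of rows that it meets, minus one. -/
def stripHeight (lam ρ : YoungDiagram) : ℕ :=
  ((skewCells lam ρ).image Prod.fst).card - 1

/-- The content `lam_i - i` of the box removed from row `i` of `lam` to obtain `μ ⋖ lam`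
(rows counted from `1`). The sum has exactly one term, for the removed box `b`. -/
def boxContent (lam μ : YoungDiagram) : ℤ :=
  ∑ b ∈ skewCells lam μ, ((lam.rowLen b.1 : ℤ) - ((b.1 : ℤ) + 1))

/-- The edges `μ ⋖ ν` of the Young lattice. -/
def boxRel : SetRel YoungDiagram YoungDiagram :=
  {p | IsBoxRemoval p.1 p.2}

/-- `F_lam`, the number of directed paths in the Young lattice from the empty diagram to `lam`,
i.e. the number of standard Young tableaux of shape `lam`. -/
noncomputable def numPaths (lam : YoungDiagram) : ℕ :=
  Nat.card {p : RelSeries boxRel // p.head = ⊥ ∧ p.last = lam}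

/-- The partition `(n)` with a single part (the empty partition if `n = 0`). -/
def oneRow (n : ℕ) : YoungDiagram :=
  YoungDiagram.ofRowLens [n] (List.pairwise_singleton _ n).sortedGE

/-! ### Wronskian Laguerre polynomials -/

/-- The Wronskian Laguerre polynomial
`l_lam^{(a)} = Wr[l_{n_1}^{(a)}, …, l_{n_r}^{(a)}] / ∏_{i < j} (n_j - n_i)`, with
`(n_1, …, n_r)` the degree vector of `lam`. -/
noncomputable def wronskianLaguerre {K : Type*} [Field K] (a : K) (lam : YoungDiagram) : K[X] :=
  C (∏ i : Fin (lam.colLen 0), ∏ j ∈ Finset.Ioi i,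
      ((degreeVector lam j : K) - (degreeVector lam i : K)))⁻¹ *
    wronskianDet fun i => modifiedLaguerre a (degreeVector lam i)

end WronskianLaguerre

open WronskianLaguerre

namespace WronskianLaguerre

/-! ### Laguerre identities and the normalized Appell sequence -/

section LaguerreIdentities

variable {K : Type*} [Field K]

/-! Put `p_k = l_k / k!`, with `p_k = 0` for `k < 0`. The parameter shift `α - n` makes this an
Appell sequence, `p_k' = p_{k-1}`, and it satisfies `k p_k = (x + α + 1 - k) p_{k-1} + x p_{k-2}`.
By the Appell property the Wronskian is, up to factorials and the sign of an order reversal, the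
Jacobi–Trudi determinant `det (p_{b_i + j})` with `b_i = λ_i - i` (indices from 0). The Vandermonde
product in the denominator is, with the same factors, the determinant for `1 / k!`, which equals
`F_λ / |λ|!`. Hence `F_λ l_λ = |λ|! det (p_{b_i + j})` (`numPaths_mul_wronskianLaguerre`).

It remains to expand such a determinant for any sequence with `k h_k = (u - k v) h_{k-1} + w
h_{k-2}` (`jacobiTrudi_recurrence`). The recurrence is applied in one row at a time. The
coefficients depending on the column `j` amount to multiplying the matrix by a fixed bidiagonal
matrix on the right, and the sum over rows of such replacements contributes only its trace
(`sum_det_updateRow_mul`). What is left is the sum of the determinants with `b_i` lowered by 1 or by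
2. Lowering by 1 either removes a box or creates two equal rows. Lowering by 2 removes a horizontal
domino, or a vertical one after a row swap (the sign `(-1)^ht`), or gives zero.

The resulting identity `card_mul_jacobiTrudi` is used twice: for `1 / k!` it is the branching rule
that identifies `F_λ`, and for `p_k` it is the theorem. -/

theorem laguerre_zero (a : K) : laguerre a 0 = 1 := rfl

theorem laguerre_one (a : K) : laguerre a 1 = -X + C (a + 1) := rfl

/-- The normalized polynomials `l_k / k!`, extended by zero to negative indices. -/
noncomputable def normalizedLaguerre (α : K) : ℤ → K[X]
  | Int.ofNat n => C ((n.factorial : K)⁻¹) * modifiedLaguerre α n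
  | Int.negSucc _ => 0

theorem normalizedLaguerre_natCast (α : K) (n : ℕ) :
    normalizedLaguerre α n = C ((n.factorial : K)⁻¹) * modifiedLaguerre α n := rfl

theorem normalizedLaguerre_of_neg (α : K) {k : ℤ} (hk : k < 0) : normalizedLaguerre α k = 0 := by
  cases k with
  | ofNat n => exact absurd hk (by simp)
  | negSucc n => rfl

theorem normalizedLaguerre_zero (α : K) : normalizedLaguerre α 0 = 1 := by
  have := normalizedLaguerre_natCast α 0
  simpa [modifiedLaguerre, laguerre] using this

variable [CharZero K]

theorem laguerre_recurrence (a : K) (n : ℕ) :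
    ((n : K[X]) + 2) * laguerre a (n + 2) =
      (2 * (n : K[X]) + 3 + C a - X) * laguerre a (n + 1) - ((n : K[X]) + 1 + C a) * laguerre a n := by
  have h0 : ((n : K) + 2) ≠ 0 := by exact_mod_cast (by omega : n + 2 ≠ 0)
  have h : ((n : K[X]) + 2) * C ((((n + 2 : ℕ) : K))⁻¹) = 1 := by
    have : ((n : K[X]) + 2) = C ((n : K) + 2) := by rw [C_add, map_natCast, C_ofNat]
    rw [this, ← C_mul]
    push_cast
    rw [mul_inv_cancel₀ h0, C_1]
  rw [laguerre, div_eq_mul_inv]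
  simp only [C_add, C_mul, C_sub, C_1]
  linear_combination
    ((-X + (C a - 1)) * laguerre a (n + 1) - (C a - 1) * laguerre a n) * h

/-- The contiguity relation `L_{n+1}^{(a)} = L_{n+1}^{(a+1)} - L_n^{(a+1)}`. -/
theorem laguerre_contiguous (a : K) (n : ℕ) :
    laguerre a (n + 1) = laguerre (a + 1) (n + 1) - laguerre (a + 1) n := by
  induction n using Nat.twoStepInduction with
  | zero => simp [laguerre]; ring
  | one =>
    have h2 : (2 : K[X]) ≠ 0 := two_ne_zero
    have e1 := laguerre_recurrence a 0
    have e2 := laguerre_recurrence (a + 1) 0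
    simp only [zero_add, Nat.cast_zero, mul_zero, laguerre_zero, laguerre_one, C_add, C_1,
      Nat.reduceAdd] at e1 e2 ⊢
    apply mul_left_cancel₀ h2
    linear_combination e1 - e2
  | more n ih1 ih2 =>
    have h3 : ((n : K[X]) + 3) ≠ 0 := by exact_mod_cast (by omega : n + 3 ≠ 0)
    have e1 := laguerre_recurrence a (n + 1)
    have e2 := laguerre_recurrence (a + 1) (n + 1)
    have e3 := laguerre_recurrence (a + 1) n
    push_cast [C_add, C_1] at e1 e2 e3
    apply mul_left_cancel₀ h3
    linear_combination e1 - e2 + e3 + (2 * (n : K[X]) + 5 + C a - X) * ih2 - ((n : K[X]) + 2 + C a) * ih1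

/-- Contiguity moves every term to the parameter `a + 1`, where the claim is the defining three-term
recurrence. -/
theorem laguerre_succ_eq (a : K) (n : ℕ) :
    ((n : K[X]) + 1) * laguerre a (n + 1) =
      ((n : K[X]) + 1 + C a) * laguerre a n - X * laguerre (a + 1) n := by
  cases n with
  | zero => simp [laguerre]; ring
  | succ n =>
    have e1 := laguerre_recurrence (a + 1) n
    have c1 := laguerre_contiguous a n
    have c2 := laguerre_contiguous a (n + 1)
    push_cast [C_add, C_1] at e1 ⊢
    rw [c1, c2]
    linear_combination e1

/-- Differentiate the three-term recurrence. The extra term coming from the factor `-X` is moved to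
the parameter `a + 1` by contiguity. -/
theorem derivative_laguerre (a : K) (n : ℕ) :
    derivative (laguerre a (n + 1)) = - laguerre (a + 1) n := by
  induction n using Nat.twoStepInduction with
  | zero => simp [laguerre]
  | one =>
    have h2 : (2 : K[X]) ≠ 0 := two_ne_zero
    have e1 := congrArg derivative (laguerre_recurrence a 0)
    simp only [zero_add, Nat.cast_zero, mul_zero, laguerre_zero, laguerre_one, C_add, C_1,
      Nat.reduceAdd, derivative_mul, derivative_add, derivative_sub, derivative_neg,
      derivative_X, derivative_C, derivative_one, derivative_ofNat] at e1 ⊢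
    apply mul_left_cancel₀ h2
    linear_combination e1
  | more n ih1 ih2 =>
    have h3 : ((n : K[X]) + 3) ≠ 0 := by exact_mod_cast (by omega : n + 3 ≠ 0)
    have e1 := congrArg derivative (laguerre_recurrence a (n + 1))
    have e3 := laguerre_recurrence (a + 1) n
    have c := laguerre_contiguous a (n + 1)
    simp only [Nat.cast_add, Nat.cast_one, derivative_mul, derivative_add, derivative_sub,
      derivative_X, derivative_C, derivative_one, derivative_ofNat, derivative_natCast] at e1
    simp only [C_add, C_1] at e3
    rw [ih1, ih2] at e1
    apply mul_left_cancel₀ h3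
    linear_combination e1 + e3 - c

/-- The three-term recurrence of the modified Laguerre polynomials. -/
theorem modifiedLaguerre_recurrence (α : K) (n : ℕ) :
    modifiedLaguerre α (n + 2) =
      (X + C α - ((n : K[X]) + 1)) * modifiedLaguerre α (n + 1) +
        X * ((n : K[X]) + 1) * modifiedLaguerre α n := by
  -- At these parameters the coefficients `n + 2 + a` and `n + 1 + a` both collapse to `α`.
  -- Contiguity leaves a term `-α L_n^{(α-n-1)}`, foreign to the family, which cancels on adding
  -- `e2`.
  have e1 := laguerre_succ_eq (α - ((n + 2 : ℕ) : K)) (n + 1)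
  have e2 := laguerre_succ_eq (α - ((n + 1 : ℕ) : K)) n
  have c := laguerre_contiguous (α - ((n + 2 : ℕ) : K)) n
  rw [show α - ((n + 2 : ℕ) : K) + 1 = α - ((n + 1 : ℕ) : K) by push_cast; ring] at e1 c
  rw [show α - ((n + 1 : ℕ) : K) + 1 = α - (n : K) by push_cast; ring] at e2
  rw [c] at e1
  have key := congrArg (fun p : K[X] => p.comp (-X)) e1
  have key2 := congrArg (fun p : K[X] => p.comp (-X)) e2
  simp only [modifiedLaguerre, Nat.factorial_succ]
  simp only [mul_comp, add_comp, sub_comp, natCast_comp, one_comp, C_comp, X_comp] at key key2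
  push_cast [C_sub, C_add] at key key2 ⊢
  simp only [map_natCast, map_ofNat, C_1] at key key2
  linear_combination (n.factorial : K[X]) * (n + 1) * (key + key2)

/-- Differentiation raises the Laguerre parameter by one, exactly what the shift `α - n` gains when
the degree drops, so `α` stays fixed. -/
theorem derivative_modifiedLaguerre (α : K) (n : ℕ) :
    derivative (modifiedLaguerre α (n + 1)) = ((n : K[X]) + 1) * modifiedLaguerre α n := by
  have e := derivative_laguerre (α - ((n + 1 : ℕ) : K)) n
  rw [show α - ((n + 1 : ℕ) : K) + 1 = α - (n : K) by push_cast; ring] at e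
  rw [modifiedLaguerre, modifiedLaguerre, derivative_mul, derivative_comp, e, Nat.factorial_succ]
  simp
  ring

theorem factorial_mul_normalizedLaguerre (α : K) (n : ℕ) :
    (n.factorial : K[X]) * normalizedLaguerre α n = modifiedLaguerre α n := by
  have h : (n.factorial : K) ≠ 0 := by exact_mod_cast n.factorial_ne_zero
  rw [normalizedLaguerre_natCast, ← map_natCast (C : K →+* K[X]), ← mul_assoc, ← C_mul,
    mul_inv_cancel₀ h, C_1, one_mul]

/-- The factor `* 1` keeps the shape `u - k * v` of `jacobiTrudi_recurrence`, with `u = X + C α +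
1`, `v = 1`, `w = X`. Extension by zero makes it hold for all integers. -/
theorem normalizedLaguerre_recurrence (α : K) (k : ℤ) :
    (k : K[X]) * normalizedLaguerre α k =
      (X + C α + 1 - (k : K[X]) * 1) * normalizedLaguerre α (k - 1) + X * normalizedLaguerre α (k - 2) := by
  rcases lt_or_ge k 0 with hk | hk
  · simp [normalizedLaguerre_of_neg, hk, (by omega : k - 1 < 0), (by omega : k - 2 < 0)]
  lift k to ℕ using hk
  match k with
  | 0 => simp [normalizedLaguerre_of_neg]
  | 1 =>
    have h1 := normalizedLaguerre_natCast α 1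
    rw [h1]
    simp [normalizedLaguerre_of_neg, normalizedLaguerre_zero, modifiedLaguerre, laguerre]
  | n + 2 =>
    have h : (((n + 1).factorial : ℕ) : K[X]) ≠ 0 := by
      exact_mod_cast (n + 1).factorial_ne_zero
    apply mul_left_cancel₀ h
    have e := modifiedLaguerre_recurrence α n
    rw [← factorial_mul_normalizedLaguerre, ← factorial_mul_normalizedLaguerre,
      ← factorial_mul_normalizedLaguerre, Nat.factorial_succ (n + 1)] at e
    rw [show ((n + 2 : ℕ) : ℤ) - 1 = (n + 1 : ℕ) by push_cast; ring,
      show ((n + 2 : ℕ) : ℤ) - 2 = (n : ℕ) by push_cast; ring]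
    rw [Nat.factorial_succ n] at e ⊢
    push_cast at e ⊢
    linear_combination e

theorem derivative_normalizedLaguerre (α : K) (k : ℤ) :
    derivative (normalizedLaguerre α k) = normalizedLaguerre α (k - 1) := by
  rcases lt_or_ge k 0 with hk | hk
  · simp [normalizedLaguerre_of_neg, hk, (by omega : k - 1 < 0)]
  lift k to ℕ using hk
  match k with
  | 0 => simp [normalizedLaguerre_of_neg, normalizedLaguerre_zero]
  | n + 1 =>
    have h : (((n + 1).factorial : ℕ) : K[X]) ≠ 0 := by
      exact_mod_cast (n + 1).factorial_ne_zero
    apply mul_left_cancel₀ h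
    have e := derivative_modifiedLaguerre α n
    rw [← factorial_mul_normalizedLaguerre, ← factorial_mul_normalizedLaguerre,
      derivative_mul, derivative_natCast, zero_mul, zero_add] at e
    rw [e, show ((n + 1 : ℕ) : ℤ) - 1 = (n : ℕ) by push_cast; ring, Nat.factorial_succ]
    push_cast
    ring

theorem iterate_derivative_modifiedLaguerre (α : K) (n i : ℕ) :
    derivative^[i] (modifiedLaguerre α n) =
      (n.factorial : K[X]) * normalizedLaguerre α ((n : ℤ) - i) := by
  induction i with
  | zero => simp [factorial_mul_normalizedLaguerre]
  | succ i ih =>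
    rw [Function.iterate_succ_apply', ih, derivative_mul, derivative_natCast,
      derivative_normalizedLaguerre]
    push_cast
    rw [sub_sub]
    ring

end LaguerreIdentities

/-! ### Jacobi–Trudi determinants of an arbitrary sequence -/

section JacobiTrudi

variable {R : Type*} [CommRing R]

/-- By Cramer's rule, putting row `i` of `B` into `A` gives the determinant `(B adj A)_{ii}`. For `B
= A M` the sum is `tr (A M adj A) = tr (adj A A M) = det A tr M`. -/
theorem sum_det_updateRow_mul {n : Type*} [Fintype n] [DecidableEq n] (A M : Matrix n n R) :
    ∑ i, (A.updateRow i ((A * M) i)).det = M.trace * A.det := by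
  have h : ∀ i, (A.updateRow i ((A * M) i)).det = (A * M * A.adjugate) i i := by
    intro i
    have := congrFun (Matrix.cramer_eq_adjugate_mulVec A.transpose ((A * M).row i)) i
    rw [Matrix.cramer_transpose_apply, ← Matrix.adjugate_transpose,
      Matrix.mulVec_transpose] at this
    exact this
  simp_rw [h]
  change (A * M * A.adjugate).trace = _
  rw [Matrix.trace_mul_cycle, Matrix.adjugate_mul, Matrix.smul_mul, Matrix.trace_smul,
    Matrix.one_mul, smul_eq_mul, mul_comm]

/-- The Jacobi–Trudi determinant `det (h_{b_i + j})_{i, j < N}`. -/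
def jacobiTrudi (h : ℤ → R) (N : ℕ) (b : ℕ → ℤ) : R :=
  Matrix.det (Matrix.of fun i j : Fin N => h (b i + (j : ℕ)))

theorem jacobiTrudi_update (h : ℤ → R) (N : ℕ) (b : ℕ → ℤ) (i : Fin N) (c : ℤ) :
    jacobiTrudi h N (Function.update b i c) =
      ((Matrix.of fun i j : Fin N => h (b i + (j : ℕ))).updateRow i
        fun j => h (c + (j : ℕ))).det := by
  unfold jacobiTrudi
  congr 1
  ext k j
  by_cases hk : k = i
  · subst hk; simp
  · have : (k : ℕ) ≠ i := fun e => hk (Fin.ext e)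
    simp [Matrix.updateRow_ne hk, Function.update_of_ne this]

/-- In row `i` the recurrence has `k = b_i + j`. The part with `b_i` is constant along the row and
comes out of the determinant; the part with `j` is the same for all rows and is handled by a trace.
-/
theorem jacobiTrudi_recurrence (h : ℤ → R) (u v w : R)
    (hrec : ∀ k : ℤ, (k : R) * h k = (u - k * v) * h (k - 1) + w * h (k - 2))
    (N : ℕ) (b : ℕ → ℤ) :
    ((∑ i ∈ Finset.range N, (b i + i) : ℤ) : R) * jacobiTrudi h N b =
      ∑ i ∈ Finset.range N, (u - b i * v) * jacobiTrudi h N (Function.update b i (b i - 1)) +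
        w * ∑ i ∈ Finset.range N, jacobiTrudi h N (Function.update b i (b i - 2)) := by
  rw [Finset.sum_range, Finset.sum_range, Finset.sum_range]
  simp_rw [jacobiTrudi_update]
  set A : Matrix (Fin N) (Fin N) R := Matrix.of fun i j : Fin N => h (b i + (j : ℕ)) with hA
  -- Right multiplication by `M` produces the two `j`-dependent terms: the diagonal gives `-j
  -- h_{b_i+j}`, the superdiagonal `-v j h_{b_i+j-1}` from the preceding column.
  let M : Matrix (Fin N) (Fin N) R := Matrix.of fun k j =>
    if k = j then -((j : ℕ) : R) else if (k : ℕ) + 1 = j then -(v * (j : ℕ)) else 0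
  have hM : M.trace = -∑ i : Fin N, ((i : ℕ) : R) := by
    simp [Matrix.trace, M]
  have hAM : ∀ i j, (A * M) i j =
      -((j : ℕ) : R) * h (b i + (j : ℕ)) - v * (j : ℕ) * h (b i + (j : ℕ) - 1) := by
    intro i j
    have hsplit : ∀ k : Fin N, A i k * M k j =
        (if k = j then -((j : ℕ) : R) * h (b i + (j : ℕ)) else 0) +
        (if (k : ℕ) + 1 = j then -(v * (j : ℕ)) * h (b i + (j : ℕ) - 1) else 0) := by
      intro k
      simp only [A, M, Matrix.of_apply]
      by_cases h1 : k = j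
      · subst h1; simp [mul_comm]
      · by_cases h2 : (k : ℕ) + 1 = j
        · simp only [h1, h2, if_true, if_false, zero_add]
          rw [mul_comm, ← h2]
          push_cast
          congr 2
          ring
        · simp [h1, h2]
    rw [Matrix.mul_apply, Finset.sum_congr rfl fun k _ => hsplit k, Finset.sum_add_distrib,
      Finset.sum_ite_eq' Finset.univ j, if_pos (Finset.mem_univ _)]
    -- Column 0 has no predecessor, but there the coefficient `v * j` vanishes.
    rcases j with ⟨j, hj⟩
    cases j with
    | zero => simp
    | succ j =>
      rw [Finset.sum_eq_single (⟨j, by omega⟩ : Fin N)]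
      · simp; ring
      · intro k _ hk
        rw [if_neg]
        intro e
        apply hk
        ext
        simpa using e
      · simp
  have hrow : ∀ i : Fin N, (b i : R) * A.det =
      (u - b i * v) * (A.updateRow i fun j => h (b i - 1 + (j : ℕ))).det +
        w * (A.updateRow i fun j => h (b i - 2 + (j : ℕ))).det +
        (A.updateRow i ((A * M) i)).det := by
    intro i
    conv_lhs => rw [← Matrix.updateRow_eq_self A i]
    rw [← Matrix.det_updateRow_smul, ← Matrix.det_updateRow_smul, ← Matrix.det_updateRow_smul,
      ← Matrix.det_updateRow_add, ← Matrix.det_updateRow_add]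
    congr 2
    ext j
    simp only [Pi.smul_apply, Pi.add_apply, smul_eq_mul, hAM]
    have := hrec (b i + (j : ℕ))
    rw [show b i - 1 + ((j : ℕ) : ℤ) = b i + (j : ℕ) - 1 by ring,
      show b i - 2 + ((j : ℕ) : ℤ) = b i + (j : ℕ) - 2 by ring]
    push_cast at this
    simp only [hA, Matrix.of_apply]
    linear_combination this
  have hsum := Finset.sum_congr rfl fun i (_ : i ∈ (Finset.univ : Finset (Fin N))) => hrow i
  rw [Finset.sum_add_distrib, Finset.sum_add_distrib, sum_det_updateRow_mul, hM,
    ← Finset.sum_mul, ← Finset.mul_sum] at hsum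
  rw [show jacobiTrudi h N b = A.det from rfl]
  push_cast
  rw [Finset.sum_add_distrib, add_mul, hsum]
  ring

theorem jacobiTrudi_congr (h : ℤ → R) (N : ℕ) {b b' : ℕ → ℤ} (hb : ∀ i < N, b i = b' i) :
    jacobiTrudi h N b = jacobiTrudi h N b' := by
  unfold jacobiTrudi
  congr 1
  ext i j
  simp [hb i i.2]

/-- The determinant vanishes if two entries of `b` agree, where entries beyond the size of the
matrix stand for zero rows. -/
theorem jacobiTrudi_eq_zero {h : ℤ → R} (hneg : ∀ k < 0, h k = 0) {N : ℕ} {b : ℕ → ℤ}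
    {i j : ℕ} (hi : i < N) (hij : i ≠ j) (hb : b i = b j) (hj : N ≤ j → b j ≤ -N) :
    jacobiTrudi h N b = 0 := by
  rcases lt_or_ge j N with hjN | hjN
  · apply Matrix.det_zero_of_row_eq (i := ⟨i, hi⟩) (j := ⟨j, hjN⟩)
    · simpa using hij
    · ext k; simp [hb]
  · apply Matrix.det_eq_zero_of_row_eq_zero ⟨i, hi⟩
    intro k
    have := hj hjN
    exact hneg _ (by simp only [hb]; omega)

theorem jacobiTrudi_swap (h : ℤ → R) {N : ℕ} (b : ℕ → ℤ) {i j : ℕ} (hi : i < N) (hj : j < N)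
    (hij : i ≠ j) : jacobiTrudi h N (b ∘ Equiv.swap i j) = - jacobiTrudi h N b := by
  have hne : (⟨i, hi⟩ : Fin N) ≠ ⟨j, hj⟩ := by simpa using hij
  have := Matrix.det_permute (Equiv.swap (⟨i, hi⟩ : Fin N) ⟨j, hj⟩)
    (Matrix.of fun i j : Fin N => h (b i + (j : ℕ)))
  rw [Equiv.Perm.sign_swap hne] at this
  unfold jacobiTrudi
  simp only [Units.val_neg, Units.val_one, Int.cast_neg, Int.cast_one, neg_mul, one_mul] at this
  rw [← this]
  congr 1
  ext k l
  simp only [Matrix.of_apply, Matrix.submatrix_apply, id, Function.comp]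
  congr 3
  simp only [Equiv.swap_apply_def, Fin.ext_iff]
  split_ifs <;> rfl

/-- For `b N = -N` the last row is `(0, …, 0, 1)`. -/
theorem jacobiTrudi_succ {h : ℤ → R} (hneg : ∀ k < 0, h k = 0) (h0 : h 0 = 1) {N : ℕ}
    {b : ℕ → ℤ} (hb : b N = -N) : jacobiTrudi h (N + 1) b = jacobiTrudi h N b := by
  unfold jacobiTrudi
  rw [Matrix.det_succ_row _ (Fin.last N), Finset.sum_eq_single (Fin.last N)]
  · simp only [Matrix.of_apply, Fin.val_last, hb, neg_add_cancel, h0, mul_one]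
    rw [Even.neg_one_pow ⟨N, rfl⟩, one_mul]
    congr 1
    ext i j
    simp
  · intro j _ hj
    have hlt : (j : ℕ) < N := Fin.val_lt_last hj
    simp only [Matrix.of_apply, Fin.val_last, hb]
    rw [hneg _ (by omega)]
    ring
  · simp

/-- This lets a diagram and its subdiagrams with fewer rows share one matrix size. -/
theorem jacobiTrudi_stable {h : ℤ → R} (hneg : ∀ k < 0, h k = 0) (h0 : h 0 = 1) {N M : ℕ}
    {b : ℕ → ℤ} (hNM : N ≤ M) (hb : ∀ i, N ≤ i → b i = -i) :
    jacobiTrudi h M b = jacobiTrudi h N b := by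
  induction M, hNM using Nat.le_induction with
  | base => rfl
  | succ M hM ih => rw [jacobiTrudi_succ hneg h0 (hb M hM), ih]

end JacobiTrudi

/-! ### Box and domino removals in terms of row lengths -/

section Diagrams

theorem youngDiagram_ext {μ ν : YoungDiagram} (h : ∀ i, μ.rowLen i = ν.rowLen i) : μ = ν := by
  apply YoungDiagram.ext
  ext ⟨i, j⟩
  rw [YoungDiagram.mem_cells, YoungDiagram.mem_cells, YoungDiagram.mem_iff_lt_rowLen,
    YoungDiagram.mem_iff_lt_rowLen, h]

theorem rowLen_le {μ lam : YoungDiagram} (h : μ ≤ lam) (i : ℕ) : μ.rowLen i ≤ lam.rowLen i := by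
  by_contra! hlt
  have h1 : (i, lam.rowLen i) ∈ μ := YoungDiagram.mem_iff_lt_rowLen.2 hlt
  exact lt_irrefl _ (YoungDiagram.mem_iff_lt_rowLen.1 (h h1))

/-- The subdiagram of `lam` whose row lengths are bounded by `f`. -/
def boundRows (lam : YoungDiagram) (f : ℕ → ℕ) : YoungDiagram where
  -- Bounding by all earlier values of `f` gives a lower set even if `f` is not antitone.
  cells := lam.cells.filter fun c => ∀ k ≤ c.1, c.2 < f k
  isLowerSet := by
    rintro ⟨a, b⟩ ⟨c, d⟩ hle hmem
    obtain ⟨h1, h2⟩ := Prod.mk_le_mk.1 hle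
    simp only [Finset.coe_filter, Set.mem_ofPred_eq, YoungDiagram.mem_cells] at hmem ⊢
    exact ⟨lam.up_left_mem h1 h2 hmem.1, fun k hk => h2.trans_lt (hmem.2 k (hk.trans h1))⟩

theorem rowLen_boundRows {lam : YoungDiagram} {f : ℕ → ℕ} (hf : ∀ k, f (k + 1) ≤ f k)
    (hle : ∀ k, f k ≤ lam.rowLen k) (i : ℕ) : (boundRows lam f).rowLen i = f i := by
  have hanti : Antitone f := antitone_nat_of_succ_le hf
  have h : ∀ j, j < (boundRows lam f).rowLen i ↔ j < f i := by
    intro j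
    rw [← YoungDiagram.mem_iff_lt_rowLen, ← YoungDiagram.mem_cells]
    simp only [boundRows, Finset.mem_filter, YoungDiagram.mem_cells,
      YoungDiagram.mem_iff_lt_rowLen]
    constructor
    · exact fun h => h.2 i le_rfl
    · exact fun h => ⟨h.trans_le (hle i), fun k hk => h.trans_le (hanti hk)⟩
  exact le_antisymm (by by_contra! hc; exact lt_irrefl _ ((h _).1 hc))
    (by by_contra! hc; exact lt_irrefl _ ((h _).2 hc))

theorem mem_skewCells {lam μ : YoungDiagram} {i j : ℕ} :
    (i, j) ∈ skewCells lam μ ↔ j < lam.rowLen i ∧ μ.rowLen i ≤ j := by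
  simp [skewCells, YoungDiagram.mem_iff_lt_rowLen]

theorem rowLen_succ_le (lam : YoungDiagram) (i : ℕ) : lam.rowLen (i + 1) ≤ lam.rowLen i :=
  lam.rowLen_anti _ _ (Nat.le_succ i)

theorem rowLen_eq_zero {lam : YoungDiagram} {N : ℕ} (hN : lam.rowLen N = 0) {i : ℕ} (hi : N ≤ i) :
    lam.rowLen i = 0 :=
  Nat.le_zero.1 (hN ▸ lam.rowLen_anti _ _ hi)

theorem rowLen_colLen (lam : YoungDiagram) : lam.rowLen (lam.colLen 0) = 0 := by
  by_contra h
  have : (lam.colLen 0, 0) ∈ lam := YoungDiagram.mem_iff_lt_rowLen.2 (Nat.pos_of_ne_zero h)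
  exact lt_irrefl _ (YoungDiagram.mem_iff_lt_colLen.1 this)

theorem card_eq_sum_rowLen {lam : YoungDiagram} {N : ℕ} (hN : lam.rowLen N = 0) :
    lam.card = ∑ i ∈ Finset.range N, lam.rowLen i := by
  rw [YoungDiagram.card, Finset.card_eq_sum_card_fiberwise (f := Prod.fst) (t := Finset.range N)]
  · exact Finset.sum_congr rfl fun i _ => (YoungDiagram.rowLen_eq_card lam).symm
  · rintro ⟨i, j⟩ hc
    simp only [Finset.coe_range, Set.mem_Iio]
    by_contra! hi
    have := YoungDiagram.mem_iff_lt_rowLen.1 ((YoungDiagram.mem_cells _).1 hc)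
    rw [rowLen_eq_zero hN hi] at this
    omega

theorem card_skewCells {lam μ : YoungDiagram} (h : μ ≤ lam) :
    (skewCells lam μ).card + μ.card = lam.card :=
  Finset.card_sdiff_add_card_eq_card (YoungDiagram.cells_subset_iff.2 h)

/-- The rows of `μ ⋖ lam` differ from those of `lam` in exactly one row, by one box. -/
theorem isBoxRemoval_iff {μ lam : YoungDiagram} :
    IsBoxRemoval μ lam ↔ ∃ i, skewCells lam μ = {(i, lam.rowLen i - 1)} ∧
      lam.rowLen (i + 1) < lam.rowLen i ∧
      ∀ k, μ.rowLen k = if k = i then lam.rowLen i - 1 else lam.rowLen k := by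
  constructor
  · rintro ⟨hle, hcard⟩
    have hc := card_skewCells hle
    obtain ⟨⟨i, j⟩, hij⟩ := Finset.card_eq_one.1 (by omega : (skewCells lam μ).card = 1)
    have hmem : ∀ a b, (b < lam.rowLen a ∧ μ.rowLen a ≤ b) ↔ (a = i ∧ b = j) := by
      intro a b
      rw [← mem_skewCells, hij]
      simp
    have hrow : ∀ k, k ≠ i → μ.rowLen k = lam.rowLen k := by
      intro k hk
      by_contra hne
      have := rowLen_le hle k
      exact hk ((hmem k (μ.rowLen k)).1 ⟨by omega, le_rfl⟩).1
    have h1 := (hmem i j).2 ⟨rfl, rfl⟩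
    have h2 := (hmem i (lam.rowLen i - 1)).1 ⟨by omega, by omega⟩
    have h3 := (hmem i (μ.rowLen i)).1 ⟨by omega, le_rfl⟩
    refine ⟨i, by rw [hij, h2.2], ?_, ?_⟩
    · have := hrow (i + 1) (by omega)
      have := rowLen_succ_le μ i
      omega
    · intro k
      split_ifs with hk
      · subst hk; omega
      · exact hrow k hk
  · rintro ⟨i, hs, -, hk⟩
    have hle : μ ≤ lam := by
      rintro ⟨a, b⟩ hab
      have hab' : b < μ.rowLen a := YoungDiagram.mem_iff_lt_rowLen.1 hab
      refine YoungDiagram.mem_iff_lt_rowLen.2 ?_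
      rw [hk a] at hab'
      split_ifs at hab' with h
      · subst h; omega
      · exact hab'
    refine ⟨hle, ?_⟩
    have := card_skewCells hle
    rw [hs, Finset.card_singleton] at this
    omega

theorem boxContent_eq {lam μ : YoungDiagram} {i j : ℕ} (h : skewCells lam μ = {(i, j)}) :
    boxContent lam μ = (lam.rowLen i : ℤ) - i - 1 := by
  rw [boxContent, h, Finset.sum_singleton]
  ring

/-- A pair of cells is a border strip if and only if they share a side. -/
theorem isBorderStrip_pair {c d : ℕ × ℕ} (hcd : c ≠ d) :
    IsBorderStrip {c, d} ↔ (SimpleGraph.hasse (ℕ × ℕ)).Adj c d := by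
  constructor
  · rintro ⟨hconn, -⟩
    have : Nontrivial ((({c, d} : Finset (ℕ × ℕ)) : Set (ℕ × ℕ))) :=
      ⟨⟨c, by simp⟩, ⟨d, by simp⟩, by simpa using hcd⟩
    obtain ⟨⟨e, he⟩, hadj⟩ := hconn.preconnected.exists_adj_of_nontrivial ⟨c, by simp⟩
    have hadj' : (SimpleGraph.hasse (ℕ × ℕ)).Adj c e := hadj
    simp only [Finset.coe_insert, Finset.coe_singleton, Set.mem_insert_iff,
      Set.mem_singleton_iff] at he
    rcases he with rfl | rfl
    · exact absurd hadj' (SimpleGraph.irrefl _)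
    · exact hadj'
  · intro hadj
    refine ⟨?_, ?_⟩
    · rw [Finset.coe_insert, Finset.coe_singleton]
      exact SimpleGraph.induce_pair_connected_of_adj hadj
    · rintro i j ⟨h1, h2, h3, -⟩
      have : ({(i, j), (i, j + 1), (i + 1, j)} : Finset (ℕ × ℕ)) ⊆ {c, d} := by
        intro x hx
        simp only [Finset.mem_insert, Finset.mem_singleton] at hx
        rcases hx with rfl | rfl | rfl <;> assumption
      have hle := (Finset.card_le_card this).trans Finset.card_le_two
      rw [Finset.card_insert_of_notMem (by simp), Finset.card_insert_of_notMem (by simp),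
        Finset.card_singleton] at hle
      omega

theorem hasse_adj_iff {a b c d : ℕ} : (SimpleGraph.hasse (ℕ × ℕ)).Adj (a, b) (c, d) ↔
    (a = c ∧ (d = b + 1 ∨ b = d + 1)) ∨ (b = d ∧ (c = a + 1 ∨ a = c + 1)) := by
  rw [SimpleGraph.hasse_adj, Prod.mk_covBy_mk_iff, Prod.mk_covBy_mk_iff]
  simp only [Nat.covBy_iff_add_one_eq]
  omega

/-- A horizontal domino at the end of row `i` of `lam`. -/
def IsHorizontalDomino (ρ lam : YoungDiagram) (i : ℕ) : Prop :=
  skewCells lam ρ = {(i, lam.rowLen i - 2), (i, lam.rowLen i - 1)} ∧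
    lam.rowLen (i + 1) + 2 ≤ lam.rowLen i ∧
    ∀ k, ρ.rowLen k = if k = i then lam.rowLen i - 2 else lam.rowLen k

/-- A vertical domino at the end of rows `i` and `i + 1` of `lam`. -/
def IsVerticalDomino (ρ lam : YoungDiagram) (i : ℕ) : Prop :=
  skewCells lam ρ = {(i, lam.rowLen i - 1), (i + 1, lam.rowLen i - 1)} ∧
    lam.rowLen (i + 1) = lam.rowLen i ∧ lam.rowLen (i + 2) < lam.rowLen i ∧
    ∀ k, ρ.rowLen k = if k = i ∨ k = i + 1 then lam.rowLen i - 1 else lam.rowLen k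

theorem isHorizontalDomino_of_skewCells {ρ lam : YoungDiagram} (hle : ρ ≤ lam) {i j : ℕ}
    (h : skewCells lam ρ = {(i, j), (i, j + 1)}) : IsHorizontalDomino ρ lam i := by
  have hmem : ∀ a b, (b < lam.rowLen a ∧ ρ.rowLen a ≤ b) ↔ (a = i ∧ (b = j ∨ b = j + 1)) := by
    intro a b
    rw [← mem_skewCells, h]
    simp only [Finset.mem_insert, Finset.mem_singleton, Prod.mk.injEq]
    tauto
  have hrow : ∀ k, k ≠ i → ρ.rowLen k = lam.rowLen k := by
    intro k hk
    by_contra hne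
    have := rowLen_le hle k
    exact hk ((hmem k (ρ.rowLen k)).1 ⟨by omega, le_rfl⟩).1
  have h1 := (hmem i j).2 ⟨rfl, Or.inl rfl⟩
  have h1' := (hmem i (j + 1)).2 ⟨rfl, Or.inr rfl⟩
  have h2 := (hmem i (lam.rowLen i - 1)).1 ⟨by omega, by omega⟩
  have h3 := (hmem i (ρ.rowLen i)).1 ⟨by omega, le_rfl⟩
  refine ⟨?_, ?_, ?_⟩
  · rw [h, show lam.rowLen i - 2 = j by omega, show lam.rowLen i - 1 = j + 1 by omega]
  · have := hrow (i + 1) (by omega)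
    have := rowLen_succ_le ρ i
    omega
  · intro k
    split_ifs with hk
    · subst hk; omega
    · exact hrow k hk

theorem isVerticalDomino_of_skewCells {ρ lam : YoungDiagram} (hle : ρ ≤ lam) {i j : ℕ}
    (h : skewCells lam ρ = {(i, j), (i + 1, j)}) : IsVerticalDomino ρ lam i := by
  have hmem : ∀ a b, (b < lam.rowLen a ∧ ρ.rowLen a ≤ b) ↔ ((a = i ∨ a = i + 1) ∧ b = j) := by
    intro a b
    rw [← mem_skewCells, h]
    simp only [Finset.mem_insert, Finset.mem_singleton, Prod.mk.injEq]
    tauto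
  have hrow : ∀ k, ¬ (k = i ∨ k = i + 1) → ρ.rowLen k = lam.rowLen k := by
    intro k hk
    by_contra hne
    have := rowLen_le hle k
    exact hk ((hmem k (ρ.rowLen k)).1 ⟨by omega, le_rfl⟩).1
  have hrow' : ∀ k, (k = i ∨ k = i + 1) → lam.rowLen k = j + 1 ∧ ρ.rowLen k = j := by
    intro k hk
    have h1 := (hmem k j).2 ⟨hk, rfl⟩
    have h2 := (hmem k (lam.rowLen k - 1)).1 ⟨by omega, by omega⟩
    have h3 := (hmem k (ρ.rowLen k)).1 ⟨by omega, le_rfl⟩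
    omega
  have hi := hrow' i (Or.inl rfl)
  have hi' := hrow' (i + 1) (Or.inr rfl)
  refine ⟨?_, by omega, ?_, ?_⟩
  · rw [h, show lam.rowLen i - 1 = j by omega]
  · have := hrow (i + 2) (by omega)
    have := rowLen_succ_le ρ (i + 1)
    rw [show i + 1 + 1 = i + 2 by rfl] at this
    omega
  · intro k
    split_ifs with hk
    · have := hrow' k hk; omega
    · exact hrow k hk

/-- Two cells form a border strip exactly when they are adjacent, hence lie side by side in a row or
a column. -/
theorem isBorderStripRemoval_two_iff {ρ lam : YoungDiagram} :
    IsBorderStripRemoval 2 ρ lam ↔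
      ∃ i, IsHorizontalDomino ρ lam i ∨ IsVerticalDomino ρ lam i := by
  constructor
  · rintro ⟨hle, hstrip, hcard⟩
    obtain ⟨⟨a, b⟩, ⟨c, d⟩, hne, hs⟩ := Finset.card_eq_two.1 hcard
    rw [hs, isBorderStrip_pair hne, hasse_adj_iff] at hstrip
    rcases hstrip with ⟨rfl, rfl | rfl⟩ | ⟨rfl, rfl | rfl⟩
    · exact ⟨a, Or.inl (isHorizontalDomino_of_skewCells hle hs)⟩
    · exact ⟨a, Or.inl (isHorizontalDomino_of_skewCells hle (by rw [hs, Finset.pair_comm]))⟩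
    · exact ⟨a, Or.inr (isVerticalDomino_of_skewCells hle hs)⟩
    · exact ⟨c, Or.inr (isVerticalDomino_of_skewCells hle (by rw [hs, Finset.pair_comm]))⟩
  · have hsub : (∀ k, ρ.rowLen k ≤ lam.rowLen k) → ρ ≤ lam := by
      rintro h ⟨a, b⟩ hab
      exact YoungDiagram.mem_iff_lt_rowLen.2
        ((YoungDiagram.mem_iff_lt_rowLen.1 hab).trans_le (h a))
    rintro ⟨i, ⟨hs, hlt, hk⟩ | ⟨hs, heq, hlt, hk⟩⟩
    · have hne : (i, lam.rowLen i - 2) ≠ (i, lam.rowLen i - 1) := by simp; omega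
      refine ⟨hsub fun k => ?_, ?_, ?_⟩
      · rw [hk]; split_ifs with h
        · subst h; omega
        · exact le_rfl
      · rw [hs, isBorderStrip_pair hne, hasse_adj_iff]
        omega
      · rw [hs, Finset.card_pair hne]
    · have hne : (i, lam.rowLen i - 1) ≠ (i + 1, lam.rowLen i - 1) := by simp
      refine ⟨hsub fun k => ?_, ?_, ?_⟩
      · rw [hk]; split_ifs with h
        · rcases h with rfl | rfl <;> omega
        · exact le_rfl
      · rw [hs, isBorderStrip_pair hne, hasse_adj_iff]
        omega
      · rw [hs, Finset.card_pair hne]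

theorem stripHeight_horizontal {ρ lam : YoungDiagram} {i : ℕ} (h : IsHorizontalDomino ρ lam i) :
    stripHeight lam ρ = 0 := by
  rw [stripHeight, h.1]
  simp

theorem stripHeight_vertical {ρ lam : YoungDiagram} {i : ℕ} (h : IsVerticalDomino ρ lam i) :
    stripHeight lam ρ = 1 := by
  rw [stripHeight, h.1, Finset.image_insert, Finset.image_singleton, Finset.card_pair (by simp)]

theorem exists_boxRemoval {lam : YoungDiagram} {i : ℕ} (h : lam.rowLen (i + 1) < lam.rowLen i) :
    ∃ μ : YoungDiagram, skewCells lam μ = {(i, lam.rowLen i - 1)} ∧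
      ∀ k, μ.rowLen k = if k = i then lam.rowLen i - 1 else lam.rowLen k := by
  have hk := rowLen_boundRows (lam := lam)
    (f := fun k => if k = i then lam.rowLen i - 1 else lam.rowLen k)
    (fun k => by
      have := rowLen_succ_le lam k
      split_ifs with h1 h2 h2
      · omega
      · subst h1; omega
      · subst h2; omega
      · exact this)
    (fun k => by split_ifs with h1 <;> [(subst h1; omega); exact le_rfl])
  refine ⟨_, ?_, hk⟩
  ext ⟨a, b⟩
  rw [mem_skewCells, hk]
  simp only [Finset.mem_singleton, Prod.mk.injEq]
  split_ifs with h1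
  · subst h1; omega
  · omega

theorem exists_horizontalDomino {lam : YoungDiagram} {i : ℕ}
    (h : lam.rowLen (i + 1) + 2 ≤ lam.rowLen i) : ∃ ρ, IsHorizontalDomino ρ lam i := by
  have hk := rowLen_boundRows (lam := lam)
    (f := fun k => if k = i then lam.rowLen i - 2 else lam.rowLen k)
    (fun k => by
      have := rowLen_succ_le lam k
      split_ifs with h1 h2 h2
      · omega
      · subst h1; omega
      · subst h2; omega
      · exact this)
    (fun k => by split_ifs with h1 <;> [(subst h1; omega); exact le_rfl])
  refine ⟨_, ?_, h, hk⟩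
  ext ⟨a, b⟩
  rw [mem_skewCells, hk]
  simp only [Finset.mem_insert, Finset.mem_singleton, Prod.mk.injEq]
  split_ifs with h1
  · subst h1; omega
  · omega

theorem exists_verticalDomino {lam : YoungDiagram} {i : ℕ}
    (h : lam.rowLen (i + 1) = lam.rowLen i) (h' : lam.rowLen (i + 2) < lam.rowLen i) :
    ∃ ρ, IsVerticalDomino ρ lam i := by
  have hk := rowLen_boundRows (lam := lam)
    (f := fun k => if k = i ∨ k = i + 1 then lam.rowLen i - 1 else lam.rowLen k)
    (fun k => by
      have := rowLen_succ_le lam k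
      split_ifs with h1 h2 h2
      · omega
      · rcases h1 with rfl | h1 <;> omega
      · obtain rfl | rfl := h2
        · omega
        · exact Nat.le_sub_one_of_lt h'
      · exact this)
    (fun k => by
      split_ifs with h1 <;> [(rcases h1 with rfl | rfl <;> omega); exact le_rfl])
  refine ⟨_, ?_, h, h', hk⟩
  ext ⟨a, b⟩
  rw [mem_skewCells, hk]
  simp only [Finset.mem_insert, Finset.mem_singleton, Prod.mk.injEq]
  split_ifs with h1
  · rcases h1 with rfl | rfl <;> omega
  · omega

end Diagrams

/-! ### Lowered determinants as sums over removals -/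

section Expansion

variable {R : Type*} [CommRing R]

/-- The sequence `lam_i - i`, with rows counted from `0`. -/
def rowShift (lam : YoungDiagram) (i : ℕ) : ℤ := (lam.rowLen i : ℤ) - i

theorem rowShift_of_le {lam : YoungDiagram} {N : ℕ} (hN : lam.rowLen N = 0) {i : ℕ} (hi : N ≤ i) :
    rowShift lam i = -i := by
  simp [rowShift, rowLen_eq_zero hN hi]

theorem rowLen_lt_of_pos {lam : YoungDiagram} {N : ℕ} (hN : lam.rowLen N = 0) {i : ℕ}
    (hi : 0 < lam.rowLen i) : i < N := by
  by_contra! h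
  rw [rowLen_eq_zero hN h] at hi
  exact lt_irrefl _ hi

/-- The content of the box at the end of row `i` is `b_i - 1`, and removing it lowers `b_i` by one.
Rows without a removable box contribute zero. -/
theorem sum_boxRemovals {h : ℤ → R} (hneg : ∀ k < 0, h k = 0) {lam : YoungDiagram} {N : ℕ}
    (hN : lam.rowLen N = 0) (φ : ℤ → R) :
    ∑ μ ∈ boxRemovals lam, φ (boxContent lam μ) * jacobiTrudi h N (rowShift μ) =
      ∑ i ∈ Finset.range N, φ (rowShift lam i - 1) *
        jacobiTrudi h N (Function.update (rowShift lam) i (rowShift lam i - 1)) := by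
  choose! f hf using fun i => exists_boxRemoval (lam := lam) (i := i)
  symm
  rw [← Finset.sum_filter_of_ne (p := fun i => lam.rowLen (i + 1) < lam.rowLen i)]
  · refine Finset.sum_nbij f ?_ ?_ ?_ ?_
    · intro i hi
      have hi := (Finset.mem_filter.1 hi).2
      exact mem_boxRemovals.2 (isBoxRemoval_iff.2 ⟨i, (hf i hi).1, hi, (hf i hi).2⟩)
    · intro i hi j hj hij
      have h1 := (hf i (Finset.mem_filter.1 hi).2).1
      have h2 := (hf j (Finset.mem_filter.1 hj).2).1
      simp only [hij] at h1
      rw [h1, Finset.singleton_inj, Prod.mk.injEq] at h2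
      exact h2.1
    · intro μ hμ
      obtain ⟨i, hs, hlt, hk⟩ := isBoxRemoval_iff.1 (mem_boxRemovals.1 hμ)
      refine ⟨i, Finset.mem_coe.2 (Finset.mem_filter.2
        ⟨Finset.mem_range.2 (rowLen_lt_of_pos hN (by omega)), hlt⟩), ?_⟩
      exact youngDiagram_ext fun k => by rw [(hf i hlt).2, hk]
    · intro i hi
      have hi := (Finset.mem_filter.1 hi).2
      obtain ⟨hs, hk⟩ := hf i hi
      rw [boxContent_eq hs]
      congr 1
      apply jacobiTrudi_congr
      intro k _
      by_cases hki : k = i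
      · subst hki
        simp only [if_true, Function.update_self, rowShift, hk]
        omega
      · simp [hki, rowShift, hk]
  -- If `λ_{i+1} = λ_i`, then `b_i - 1 = b_{i+1}` and two rows agree. For `i = N - 1` the role of
  -- row `i + 1` is played by a zero row.
  · intro i hi hne
    by_contra hlt
    have heq := le_antisymm (rowLen_succ_le lam i) (not_lt.1 hlt)
    apply hne
    rw [jacobiTrudi_eq_zero hneg (Finset.mem_range.1 hi) (j := i + 1) (by omega), mul_zero]
    · rw [Function.update_self, Function.update_of_ne (by omega), rowShift, rowShift, heq]
      push_cast
      ring
    · intro h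
      rw [Function.update_of_ne (by omega), rowShift_of_le hN h]
      omega

/-- When `λ_{i+1} = λ_i`, the entries `b_i - 2, b_{i+1}` are those of `ρ` in the opposite order,
which costs a sign. -/
theorem jacobiTrudi_verticalDomino (h : ℤ → R) {lam ρ : YoungDiagram} {N : ℕ}
    (hN : lam.rowLen N = 0) {i : ℕ} (hρ : IsVerticalDomino ρ lam i) :
    jacobiTrudi h N (Function.update (rowShift lam) i (rowShift lam i - 2)) =
      - jacobiTrudi h N (rowShift ρ) := by
  obtain ⟨-, heq, hlt, hk⟩ := hρ
  have hi1 : i + 1 < N := rowLen_lt_of_pos hN (by omega)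
  rw [← jacobiTrudi_swap h (rowShift ρ) (by omega : i < N) hi1 (by omega)]
  apply jacobiTrudi_congr
  intro k _
  simp only [Function.comp, Equiv.swap_apply_def]
  by_cases h1 : k = i
  · subst h1
    simp only [if_true, Function.update_self, rowShift, hk, or_true]
    push_cast [Nat.cast_sub (by omega : 1 ≤ lam.rowLen k)]
    ring
  · by_cases h2 : k = i + 1
    · subst h2
      simp only [if_true, Function.update_of_ne h1, rowShift, hk, true_or, heq, if_neg h1]
      push_cast [Nat.cast_sub (by omega : 1 ≤ lam.rowLen i)]
      ring
    · simp [h1, h2, rowShift, hk]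

theorem jacobiTrudi_horizontalDomino (h : ℤ → R) {lam ρ : YoungDiagram} (N : ℕ)
    {i : ℕ} (hρ : IsHorizontalDomino ρ lam i) :
    jacobiTrudi h N (Function.update (rowShift lam) i (rowShift lam i - 2)) =
      jacobiTrudi h N (rowShift ρ) := by
  obtain ⟨-, hle, hk⟩ := hρ
  apply jacobiTrudi_congr
  intro k _
  by_cases h1 : k = i
  · subst h1
    simp only [if_true, Function.update_self, rowShift, hk]
    omega
  · simp [h1, rowShift, hk]

/-- The index is the first row in which `ρ` and `lam` differ. -/
theorem domino_unique {lam ρ : YoungDiagram} {i j : ℕ}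
    (hi : IsHorizontalDomino ρ lam i ∨ IsVerticalDomino ρ lam i)
    (hj : IsHorizontalDomino ρ lam j ∨ IsVerticalDomino ρ lam j) : i = j := by
  have key : ∀ i, IsHorizontalDomino ρ lam i ∨ IsVerticalDomino ρ lam i →
      ρ.rowLen i < lam.rowLen i ∧ ∀ k < i, ρ.rowLen k = lam.rowLen k := by
    rintro i (⟨-, h1, hk⟩ | ⟨-, h1, h2, hk⟩)
    · exact ⟨by rw [hk, if_pos rfl]; omega, fun k hlt => by rw [hk, if_neg (by omega)]⟩
    · exact ⟨by rw [hk, if_pos (Or.inl rfl)]; omega,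
        fun k hlt => by rw [hk, if_neg (by omega)]⟩
  obtain ⟨a, b⟩ := key i hi
  obtain ⟨c, d⟩ := key j hj
  rcases lt_trichotomy i j with h | h | h
  · have := d i h; omega
  · exact h
  · have := b j h; omega

theorem sum_borderStripRemovals_two {h : ℤ → R} (hneg : ∀ k < 0, h k = 0) {lam : YoungDiagram}
    {N : ℕ} (hN : lam.rowLen N = 0) :
    ∑ ρ ∈ borderStripRemovals 2 lam, (-1) ^ stripHeight lam ρ * jacobiTrudi h N (rowShift ρ) =
      ∑ i ∈ Finset.range N,
        jacobiTrudi h N (Function.update (rowShift lam) i (rowShift lam i - 2)) := by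
  classical
  have hex : ∀ i, (lam.rowLen (i + 1) + 2 ≤ lam.rowLen i ∨
      lam.rowLen (i + 1) = lam.rowLen i ∧ lam.rowLen (i + 2) < lam.rowLen i) →
      ∃ ρ, IsHorizontalDomino ρ lam i ∨ IsVerticalDomino ρ lam i := by
    rintro i (hi | ⟨hi, hi'⟩)
    · exact (exists_horizontalDomino hi).imp fun _ => Or.inl
    · exact (exists_verticalDomino hi hi').imp fun _ => Or.inr
  choose! f hf using hex
  symm
  rw [← Finset.sum_filter_of_ne (p := fun i => lam.rowLen (i + 1) + 2 ≤ lam.rowLen i ∨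
      lam.rowLen (i + 1) = lam.rowLen i ∧ lam.rowLen (i + 2) < lam.rowLen i)]
  · refine Finset.sum_nbij f ?_ ?_ ?_ ?_
    · intro i hi
      exact mem_borderStripRemovals.2
        (isBorderStripRemoval_two_iff.2 ⟨i, hf i (Finset.mem_filter.1 hi).2⟩)
    · intro i hi j hj hij
      have h1 := hf i (Finset.mem_filter.1 hi).2
      have h2 := hf j (Finset.mem_filter.1 hj).2
      rw [show f i = f j from hij] at h1
      exact domino_unique h1 h2
    · intro ρ hρ
      obtain ⟨i, hi⟩ := isBorderStripRemoval_two_iff.1 (mem_borderStripRemovals.1 hρ)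
      have hP : lam.rowLen (i + 1) + 2 ≤ lam.rowLen i ∨
          lam.rowLen (i + 1) = lam.rowLen i ∧ lam.rowLen (i + 2) < lam.rowLen i :=
        hi.imp (fun h => h.2.1) fun h => ⟨h.2.1, h.2.2.1⟩
      refine ⟨i, Finset.mem_coe.2 (Finset.mem_filter.2
        ⟨Finset.mem_range.2 (rowLen_lt_of_pos hN (by omega)), hP⟩), ?_⟩
      refine youngDiagram_ext fun k => ?_
      rcases hf i hP with h1 | h1 <;> rcases hi with h2 | h2
      · rw [h1.2.2, h2.2.2]
      · have := h1.2.1; have := h2.2.1; omega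
      · have := h1.2.1; have := h2.2.1; omega
      · rw [h1.2.2.2, h2.2.2.2]
    · intro i hi
      rcases hf i (Finset.mem_filter.1 hi).2 with hd | hd
      · rw [stripHeight_horizontal hd, jacobiTrudi_horizontalDomino h N hd, pow_zero, one_mul]
      · rw [stripHeight_vertical hd, jacobiTrudi_verticalDomino h hN hd, pow_one, neg_one_mul]
  · intro i hi hne
    by_contra hP
    push Not at hP
    have h1 := rowLen_succ_le lam i
    have h2 : lam.rowLen (i + 2) ≤ lam.rowLen (i + 1) := rowLen_succ_le lam (i + 1)
    apply hne
    -- No domino starts in row `i` in two cases: `λ_i = λ_{i+1} = λ_{i+2}`, where `b_i - 2 =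
    -- b_{i+2}`, and `λ_i = λ_{i+1} + 1`, where `b_i - 2 = b_{i+1}`.
    by_cases heq : lam.rowLen (i + 1) = lam.rowLen i
    · have heq2 : lam.rowLen (i + 2) = lam.rowLen i := le_antisymm (by omega) (hP.2 heq)
      refine jacobiTrudi_eq_zero hneg (Finset.mem_range.1 hi) (j := i + 2) (by omega) ?_ ?_
      · rw [Function.update_self, Function.update_of_ne (by omega), rowShift, rowShift, heq2]
        push_cast
        ring
      · intro h
        rw [Function.update_of_ne (by omega), rowShift_of_le hN h]
        omega
    · refine jacobiTrudi_eq_zero hneg (Finset.mem_range.1 hi) (j := i + 1) (by omega) ?_ ?_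
      · rw [Function.update_self, Function.update_of_ne (by omega), rowShift, rowShift]
        have := hP.1
        omega
      · intro h
        rw [Function.update_of_ne (by omega), rowShift_of_le hN h]
        omega

theorem sum_rowShift_add {lam : YoungDiagram} {N : ℕ} (hN : lam.rowLen N = 0) :
    ∑ i ∈ Finset.range N, (rowShift lam i + i) = lam.card := by
  rw [card_eq_sum_rowLen hN, Nat.cast_sum]
  exact Finset.sum_congr rfl fun i _ => by rw [rowShift]; ring

/-- A three-term recurrence for `h` induces one for its Jacobi–Trudi determinants over
removals of boxes and dominoes. -/
theorem card_mul_jacobiTrudi {h : ℤ → R} (hneg : ∀ k < 0, h k = 0) {u v w : R}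
    (hrec : ∀ k : ℤ, (k : R) * h k = (u - k * v) * h (k - 1) + w * h (k - 2))
    {lam : YoungDiagram} {N : ℕ} (hN : lam.rowLen N = 0) :
    (lam.card : R) * jacobiTrudi h N (rowShift lam) =
      ∑ μ ∈ boxRemovals lam,
        (u - v - boxContent lam μ * v) * jacobiTrudi h N (rowShift μ) +
      w * ∑ ρ ∈ borderStripRemovals 2 lam,
        (-1) ^ stripHeight lam ρ * jacobiTrudi h N (rowShift ρ) := by
  have key := jacobiTrudi_recurrence h u v w hrec N (rowShift lam)
  rw [sum_rowShift_add hN, Int.cast_natCast] at key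
  -- With content `c = b_i - 1`, the coefficient `u - b_i v` is `u - v - c v`.
  rw [key, sum_boxRemovals hneg hN (fun c => u - v - c * v), sum_borderStripRemovals_two hneg hN]
  congr 1
  refine Finset.sum_congr rfl fun i _ => ?_
  push_cast
  ring

end Expansion

/-! ### Branching rule for paths in the Young lattice -/

section Paths

theorem card_lt_of_isBoxRemoval {μ lam : YoungDiagram} (h : IsBoxRemoval μ lam) :
    μ.card < lam.card := by
  have := h.2
  omega

theorem length_ne_zero_of_last_ne {p : RelSeries boxRel} (hp : p.head = ⊥) (h : p.last ≠ ⊥) :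
    p.length ≠ 0 := by
  intro h0
  apply h
  rw [← hp, RelSeries.last, show Fin.last p.length = 0 from Fin.ext h0, RelSeries.head]

/-- A path determines its endpoint, so the first components need no separate comparison. -/
theorem sigma_paths_ext {lam : YoungDiagram}
    {q q' : Σ μ : boxRemovals lam, {p : RelSeries boxRel // p.head = ⊥ ∧ p.last = μ.1}}
    (h : q.2.1 = q'.2.1) : q = q' := by
  obtain ⟨⟨μ, hμ⟩, p, h1, h2⟩ := q
  obtain ⟨⟨ν, hν⟩, p', h3, h4⟩ := q'
  obtain rfl : p = p' := h
  obtain rfl : μ = ν := h2.symm.trans h4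
  rfl

/-- Paths to `lam ≠ ⊥` split according to the last but one diagram. -/
noncomputable def pathsEquiv {lam : YoungDiagram} (hlam : lam ≠ ⊥) :
    {p : RelSeries boxRel // p.head = ⊥ ∧ p.last = lam} ≃
      Σ μ : boxRemovals lam, {p : RelSeries boxRel // p.head = ⊥ ∧ p.last = μ.1} where
  toFun p :=
    have hp : p.1.length ≠ 0 := length_ne_zero_of_last_ne p.2.1 (by rwa [p.2.2])
    ⟨⟨p.1.eraseLast.last, mem_boxRemovals.2 (by
      have := p.1.eraseLast_last_rel_last hp
      rw [p.2.2] at this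
      exact this)⟩, p.1.eraseLast, p.2.1, rfl⟩
  invFun q := ⟨q.2.1.snoc lam (by
    rw [q.2.2.2]
    exact mem_boxRemovals.1 q.1.2), by rw [RelSeries.head_snoc, q.2.2.1], by simp⟩
  left_inv := by
    rintro ⟨p, h1, rfl⟩
    exact Subtype.ext (p.snoc_self_eraseLast (length_ne_zero_of_last_ne h1 hlam))
  right_inv := by
    rintro ⟨⟨μ, hμ⟩, p, h1, h2⟩
    apply sigma_paths_ext
    apply RelSeries.toList_injective
    rw [RelSeries.toList_eraseLast _ (by simp), RelSeries.toList_snoc, List.dropLast_concat]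

instance uniquePathsBot : Unique {p : RelSeries boxRel // p.head = ⊥ ∧ p.last = ⊥} where
  default := ⟨RelSeries.singleton boxRel ⊥, by simp⟩
  uniq := by
    rintro ⟨p, h1, h2⟩
    have h0 : p.length = 0 := by
      by_contra h0
      have h := p.eraseLast_last_rel_last h0
      rw [h2] at h
      have := card_lt_of_isBoxRemoval (μ := p.eraseLast.last) (lam := ⊥) h
      exact absurd this (by simp [YoungDiagram.card])
    apply Subtype.ext
    refine RelSeries.ext h0 (funext fun i => ?_)
    have : i = 0 := Fin.ext (by
      have : (i : ℕ) < p.length + 1 := i.2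
      rw [Fin.val_zero]
      omega)
    subst this
    exact h1

/-- `Nat.card` is 0 on infinite types, so the branching rule needs finiteness of the path sets. -/
theorem finite_paths (lam : YoungDiagram) :
    Finite {p : RelSeries boxRel // p.head = ⊥ ∧ p.last = lam} := by
  by_cases hlam : lam = ⊥
  · subst hlam
    infer_instance
  · have (μ : boxRemovals lam) := finite_paths μ.1
    exact Finite.of_equiv _ (pathsEquiv hlam).symm
termination_by lam.card
decreasing_by exact card_lt_of_isBoxRemoval (mem_boxRemovals.1 μ.2)

theorem numPaths_bot : numPaths ⊥ = 1 :=
  Nat.card_unique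

theorem numPaths_eq_sum {lam : YoungDiagram} (hlam : lam ≠ ⊥) :
    numPaths lam = ∑ μ ∈ boxRemovals lam, numPaths μ := by
  have := finite_paths
  rw [numPaths, Nat.card_congr (pathsEquiv hlam), Nat.card_sigma,
    ← Finset.sum_coe_sort (boxRemovals lam)]
  rfl

end Paths

/-! ### The sequence of reciprocal factorials -/

section ReciprocalFactorial

variable (K : Type*) [Field K]

/-- The sequence `1 / k!`, extended by zero to negative indices. -/
def reciprocalFactorial : ℤ → K
  | Int.ofNat n => (n.factorial : K)⁻¹
  | Int.negSucc _ => 0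

theorem reciprocalFactorial_natCast (n : ℕ) :
    reciprocalFactorial K n = (n.factorial : K)⁻¹ := rfl

theorem reciprocalFactorial_of_neg {k : ℤ} (hk : k < 0) : reciprocalFactorial K k = 0 := by
  cases k with
  | ofNat n => exact absurd hk (by simp)
  | negSucc n => rfl

theorem reciprocalFactorial_zero : reciprocalFactorial K 0 = 1 := by
  simpa using reciprocalFactorial_natCast K 0

variable [CharZero K]

/-- The general recurrence with `u = 1` and `v = w = 0`: the domino sum drops out and every box has
weight one. -/
theorem reciprocalFactorial_recurrence (k : ℤ) :
    (k : K) * reciprocalFactorial K k =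
      (1 - (k : K) * 0) * reciprocalFactorial K (k - 1) + 0 * reciprocalFactorial K (k - 2) := by
  rw [mul_zero, sub_zero, one_mul, zero_mul, add_zero]
  rcases lt_or_ge k 0 with hk | hk
  · simp [reciprocalFactorial_of_neg, hk, (by omega : k - 1 < 0)]
  lift k to ℕ using hk
  cases k with
  | zero => simp [reciprocalFactorial_of_neg]
  | succ n =>
    rw [show ((n + 1 : ℕ) : ℤ) - 1 = (n : ℕ) by push_cast; ring, reciprocalFactorial_natCast,
      reciprocalFactorial_natCast, Nat.factorial_succ]
    have : (n : K) + 1 ≠ 0 := by exact_mod_cast n.succ_ne_zero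
    push_cast
    field_simp

theorem descFactorial_eq_factorial_mul (n k : ℕ) :
    (n.descFactorial k : K) = (n.factorial : K) * reciprocalFactorial K ((n : ℤ) - k) := by
  rcases lt_or_ge n k with h | h
  · rw [Nat.descFactorial_of_lt h, reciprocalFactorial_of_neg K (by omega)]
    simp
  · have hne : ((n - k).factorial : K) ≠ 0 := by exact_mod_cast (n - k).factorial_ne_zero
    rw [← Nat.cast_sub h, reciprocalFactorial_natCast, eq_mul_inv_iff_mul_eq₀ hne]
    exact_mod_cast (mul_comm _ _).trans (Nat.factorial_mul_descFactorial h)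

end ReciprocalFactorial

theorem card_pos_of_ne_bot {lam : YoungDiagram} (h : lam ≠ ⊥) : 0 < lam.card := by
  refine Finset.card_pos.2 (Finset.nonempty_iff_ne_empty.2 fun he => h ?_)
  exact YoungDiagram.ext he

theorem rowLen_eq_zero_of_le {μ lam : YoungDiagram} (h : μ ≤ lam) {N : ℕ}
    (hN : lam.rowLen N = 0) : μ.rowLen N = 0 :=
  Nat.le_zero.1 (hN ▸ rowLen_le h N)

/-! ### From Wronskians and path counts to Jacobi–Trudi determinants -/

section Evaluation

variable {K : Type*} [Field K] [CharZero K]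

/-- The number of standard tableaux as a determinant of reciprocal factorials. -/
theorem numPaths_eq_jacobiTrudi (lam : YoungDiagram) {N : ℕ} (hN : lam.rowLen N = 0) :
    (numPaths lam : K) =
      lam.card.factorial * jacobiTrudi (reciprocalFactorial K) N (rowShift lam) := by
  by_cases hlam : lam = ⊥
  · subst hlam
    have h0 : (⊥ : YoungDiagram).rowLen 0 = 0 := by
      by_contra h
      exact YoungDiagram.notMem_bot _ (YoungDiagram.mem_iff_lt_rowLen.2 (Nat.pos_of_ne_zero h))
    -- Stability reduces the empty diagram to the determinant of the `0 × 0` matrix.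
    rw [numPaths_bot, jacobiTrudi_stable (fun k hk => reciprocalFactorial_of_neg K hk)
      (reciprocalFactorial_zero K) (Nat.zero_le N) (fun i hi => rowShift_of_le h0 hi)]
    simp [jacobiTrudi, YoungDiagram.card]
  · have hpos := card_pos_of_ne_bot hlam
    obtain ⟨n, hn⟩ : ∃ n, lam.card = n + 1 := ⟨lam.card - 1, by omega⟩
    have key := card_mul_jacobiTrudi (fun k hk => reciprocalFactorial_of_neg K hk)
      (reciprocalFactorial_recurrence K) hN
    rw [zero_mul, add_zero] at key
    rw [numPaths_eq_sum hlam, Nat.cast_sum, hn, Nat.factorial_succ, mul_comm (n + 1), Nat.cast_mul,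
      mul_assoc, ← hn, key, Finset.mul_sum]
    refine Finset.sum_congr rfl fun μ hμ => ?_
    have hμ := mem_boxRemovals.1 hμ
    rw [numPaths_eq_jacobiTrudi μ (rowLen_eq_zero_of_le hμ.1 hN),
      show μ.card = n by have := hμ.2; omega]
    ring
termination_by lam.card
decreasing_by exact card_lt_of_isBoxRemoval hμ

/-- With indices from 0 and `r` parts, `n_j = b_j + r - 1`. Replacing `i` by `r - 1 - i` turns `n_j
- i` into `b_j + i`; the sign is that of this reversal. -/
theorem det_degreeVector {R : Type*} [CommRing R] (h : ℤ → R) (lam : YoungDiagram) :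
    (Matrix.of fun i j : Fin (lam.colLen 0) => h ((degreeVector lam j : ℤ) - (i : ℕ))).det =
      ((Equiv.Perm.sign (Fin.revPerm : Equiv.Perm (Fin (lam.colLen 0))) : ℤ) : R) *
        jacobiTrudi h (lam.colLen 0) (rowShift lam) := by
  rw [jacobiTrudi, ← Matrix.det_transpose (Matrix.of fun i j : Fin (lam.colLen 0) => _),
    ← Matrix.det_permute']
  congr 1
  ext i j
  have hi := i.2
  have hj := j.2
  simp only [Matrix.submatrix_apply, Matrix.transpose_apply, Matrix.of_apply, id,
    Fin.revPerm_apply, Fin.val_rev, degreeVector, rowShift]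
  congr 1
  omega

theorem degreeVector_injective (lam : YoungDiagram) : Function.Injective (degreeVector lam) := by
  apply StrictAnti.injective
  intro i j hij
  have := lam.rowLen_anti i j (le_of_lt hij)
  have := j.2
  have : (i : ℕ) < j := hij
  simp only [degreeVector]
  omega

theorem det_mul_factorial {R : Type*} [CommRing R] (h : ℤ → R) (lam : YoungDiagram) :
    (Matrix.of fun i j : Fin (lam.colLen 0) =>
        ((degreeVector lam j).factorial : R) * h ((degreeVector lam j : ℤ) - (i : ℕ))).det =
      (∏ j, ((degreeVector lam j).factorial : R)) *
        (((Equiv.Perm.sign (Fin.revPerm : Equiv.Perm (Fin (lam.colLen 0))) : ℤ) : R) *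
          jacobiTrudi h (lam.colLen 0) (rowShift lam)) := by
  rw [← det_degreeVector]
  exact Matrix.det_mul_row (fun j => ((degreeVector lam j).factorial : R)) _

/-- A Vandermonde determinant may be computed with any monic polynomials of degrees `0, 1, …`.
Falling factorials, `n! / (n - i)!`, give the same shape as the Wronskian, with the same factorials
and sign. -/
theorem prod_degreeVector_sub (lam : YoungDiagram) :
    ∏ i : Fin (lam.colLen 0), ∏ j ∈ Finset.Ioi i,
        ((degreeVector lam j : K) - (degreeVector lam i : K)) =
      (∏ j, ((degreeVector lam j).factorial : K)) *
        (((Equiv.Perm.sign (Fin.revPerm : Equiv.Perm (Fin (lam.colLen 0))) : ℤ) : K) *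
          jacobiTrudi (reciprocalFactorial K) (lam.colLen 0) (rowShift lam)) := by
  rw [← det_mul_factorial, ← Matrix.det_vandermonde,
    Matrix.det_eval_matrixOfPolynomials_eq_det_vandermonde _
      (fun i => descPochhammer K i) (fun i => descPochhammer_natDegree K i)
      (fun i => monic_descPochhammer K i), ← Matrix.det_transpose]
  congr 1
  ext i j
  simp only [Matrix.transpose_apply, Matrix.of_apply]
  rw [descPochhammer_eval_eq_descFactorial, descFactorial_eq_factorial_mul]

/-- The factorials and the reversal sign cancel between Wronskian and Vandermonde product, leaving a
quotient of two Jacobi–Trudi determinants, stated here without division. -/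
theorem wronskianLaguerre_eq (α : K) (lam : YoungDiagram) :
    C (jacobiTrudi (reciprocalFactorial K) (lam.colLen 0) (rowShift lam)) *
        wronskianLaguerre α lam =
      jacobiTrudi (normalizedLaguerre α) (lam.colLen 0) (rowShift lam) := by
  have hV : ∏ i : Fin (lam.colLen 0), ∏ j ∈ Finset.Ioi i,
        ((degreeVector lam j : K) - (degreeVector lam i : K)) ≠ 0 := by
    rw [← Matrix.det_vandermonde, Matrix.det_vandermonde_ne_zero_iff]
    exact Nat.cast_injective.comp (degreeVector_injective lam)
  have hW : wronskianDet (fun i => modifiedLaguerre α (degreeVector lam i)) =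
      C ((∏ j, ((degreeVector lam j).factorial : K)) *
        ((Equiv.Perm.sign (Fin.revPerm : Equiv.Perm (Fin (lam.colLen 0))) : ℤ) : K)) *
          jacobiTrudi (normalizedLaguerre α) (lam.colLen 0) (rowShift lam) := by
    simp_rw [wronskianDet, iterate_derivative_modifiedLaguerre]
    rw [det_mul_factorial, C_mul, map_prod]
    simp only [map_natCast, map_intCast]
    ring
  have hP := prod_degreeVector_sub (K := K) lam
  rw [wronskianLaguerre, hW]
  generalize ∏ i : Fin (lam.colLen 0), ∏ j ∈ Finset.Ioi i,
        ((degreeVector lam j : K) - (degreeVector lam i : K)) = V at hV hP ⊢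
  rw [← mul_assoc, ← mul_assoc, ← C_mul, ← C_mul]
  conv_rhs => rw [← one_mul (jacobiTrudi _ _ _), ← C_1, ← inv_mul_cancel₀ hV]
  congr 2
  linear_combination (-V⁻¹) * hP

/-- `F_lam l_lam` as a Jacobi–Trudi determinant. -/
theorem numPaths_mul_wronskianLaguerre (α : K) {lam : YoungDiagram} {N : ℕ}
    (hN : lam.rowLen N = 0) :
    (numPaths lam : K[X]) * wronskianLaguerre α lam =
      (lam.card.factorial : K[X]) * jacobiTrudi (normalizedLaguerre α) N (rowShift lam) := by
  have hcol : lam.colLen 0 ≤ N := by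
    by_contra! h
    have := YoungDiagram.mem_iff_lt_rowLen.1 (YoungDiagram.mem_iff_lt_colLen.2 h)
    omega
  rw [jacobiTrudi_stable (fun k hk => normalizedLaguerre_of_neg α hk) (normalizedLaguerre_zero α)
    hcol fun i hi => rowShift_of_le (rowLen_colLen lam) hi, ← wronskianLaguerre_eq,
    ← map_natCast (C : K →+* K[X]), numPaths_eq_jacobiTrudi lam (rowLen_colLen lam), C_mul,
    map_natCast, mul_assoc]

theorem sum_boxRemovals_wronskianLaguerre (α : K) {lam : YoungDiagram} {N : ℕ}
    (hN : lam.rowLen N = 0) :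
    ∑ μ ∈ boxRemovals lam, (X + C α - (boxContent lam μ : K[X])) *
        (numPaths μ : K[X]) * wronskianLaguerre α μ =
      ((lam.card - 1).factorial : K[X]) * ∑ μ ∈ boxRemovals lam,
        (X + C α - (boxContent lam μ : K[X])) *
          jacobiTrudi (normalizedLaguerre α) N (rowShift μ) := by
  rw [Finset.mul_sum]
  refine Finset.sum_congr rfl fun μ hμ => ?_
  have hμ := mem_boxRemovals.1 hμ
  rw [mul_assoc, numPaths_mul_wronskianLaguerre α (rowLen_eq_zero_of_le hμ.1 hN), hμ.2,
    Nat.add_sub_cancel]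
  ring

/-- Each `ρ` has size `|λ| - 2`, so the factor `|λ| - 1` completes `(|λ| - 2)!` to the `(|λ| - 1)!`
common to both sums. -/
theorem sum_borderStripRemovals_wronskianLaguerre (α : K) {lam : YoungDiagram} {N : ℕ}
    (hN : lam.rowLen N = 0) :
    X * ((lam.card : K[X]) - 1) * ∑ ρ ∈ borderStripRemovals 2 lam,
        (-1) ^ stripHeight lam ρ * (numPaths ρ : K[X]) * wronskianLaguerre α ρ =
      ((lam.card - 1).factorial : K[X]) * (X * ∑ ρ ∈ borderStripRemovals 2 lam,
        (-1) ^ stripHeight lam ρ * jacobiTrudi (normalizedLaguerre α) N (rowShift ρ)) := by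
  rw [← mul_assoc, Finset.mul_sum, Finset.mul_sum]
  refine Finset.sum_congr rfl fun ρ hρ => ?_
  have hρ := mem_borderStripRemovals.1 hρ
  have hcard := card_skewCells hρ.1
  rw [hρ.2.2] at hcard
  rw [mul_assoc ((-1) ^ _), numPaths_mul_wronskianLaguerre α (rowLen_eq_zero_of_le hρ.1 hN),
    ← hcard, show 2 + ρ.card - 1 = ρ.card + 1 by omega, Nat.factorial_succ]
  push_cast
  ring

end Evaluation

/-! ### One-row partitions -/

section OneRow

theorem rowLen_oneRow (n i : ℕ) : (oneRow n).rowLen i = if i = 0 then n else 0 := by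
  have h : ∀ j, j < (oneRow n).rowLen i ↔ j < if i = 0 then n else 0 := by
    intro j
    rw [← YoungDiagram.mem_iff_lt_rowLen, oneRow, YoungDiagram.mem_ofRowLens]
    cases i <;> simp
  exact le_antisymm (by by_contra! hc; exact lt_irrefl _ ((h _).1 hc))
    (by by_contra! hc; exact lt_irrefl _ ((h _).2 hc))

theorem card_oneRow (n : ℕ) : (oneRow n).card = n := by
  rw [card_eq_sum_rowLen (N := 1) (by simp [rowLen_oneRow])]
  simp [rowLen_oneRow]

theorem jacobiTrudi_one {R : Type*} [CommRing R] (h : ℤ → R) (b : ℕ → ℤ) :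
    jacobiTrudi h 1 b = h (b 0) := by
  simp [jacobiTrudi]

end OneRow

end WronskianLaguerre

theorem theorem1 {K : Type*} [Field K] [CharZero K] (α : K) :
    (∀ lam : YoungDiagram, lam ≠ ⊥ →
      (numPaths lam : K[X]) * wronskianLaguerre α lam =
        (∑ μ ∈ boxRemovals lam,
          (X + C α - (boxContent lam μ : K[X])) *
            (numPaths μ : K[X]) * wronskianLaguerre α μ) +
        X * ((lam.card : K[X]) - 1) *
          ∑ ρ ∈ borderStripRemovals 2 lam,
            (-1) ^ stripHeight lam ρ *
              (numPaths ρ : K[X]) * wronskianLaguerre α ρ) ∧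
    -- for `lam = (n)` the three terms are those of the classical three-term recurrence
    (∀ n : ℕ, 2 ≤ n →
      (numPaths (oneRow n) : K[X]) *
          wronskianLaguerre α (oneRow n) =
        modifiedLaguerre α n ∧
      (∑ μ ∈ boxRemovals (oneRow n),
          (X + C α - (boxContent (oneRow n) μ : K[X])) *
            (numPaths μ : K[X]) * wronskianLaguerre α μ) =
        (X + C α - (n : K[X]) + 1) * modifiedLaguerre α (n - 1) ∧
      X * (((oneRow n).card : K[X]) - 1) *
          (∑ ρ ∈ borderStripRemovals 2 (oneRow n),
            (-1) ^ stripHeight (oneRow n) ρ *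
              (numPaths ρ : K[X]) * wronskianLaguerre α ρ) =
        X * ((n : K[X]) - 1) * modifiedLaguerre α (n - 2)) := by
  have hneg : ∀ k < 0, normalizedLaguerre α k = 0 := fun k hk => normalizedLaguerre_of_neg α hk
  refine ⟨fun lam hlam => ?_, fun n hn => ?_⟩
  · have hN := rowLen_colLen lam
    have hpos := card_pos_of_ne_bot hlam
    have key := card_mul_jacobiTrudi hneg (normalizedLaguerre_recurrence α) hN
    rw [sum_boxRemovals_wronskianLaguerre α hN, sum_borderStripRemovals_wronskianLaguerre α hN,
      numPaths_mul_wronskianLaguerre α hN, ← mul_add,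
      ← Nat.mul_factorial_pred (Nat.pos_iff_ne_zero.1 hpos), mul_comm lam.card, Nat.cast_mul,
      mul_assoc, key]
    simp only [add_sub_cancel_right, mul_one]
  -- For `(n)` the size `N = 1` suffices: all determinants are single entries and each removal sum
  -- reduces to the term of row 0.
  · have hN : (oneRow n).rowLen 1 = 0 := by simp [rowLen_oneRow]
    have hshift : rowShift (oneRow n) 0 = n := by simp [rowShift, rowLen_oneRow]
    refine ⟨?_, ?_, ?_⟩
    · rw [numPaths_mul_wronskianLaguerre α hN, jacobiTrudi_one, hshift, card_oneRow,
        factorial_mul_normalizedLaguerre]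
    · rw [sum_boxRemovals_wronskianLaguerre α hN,
        sum_boxRemovals hneg hN (fun c => X + C α - (c : K[X])), Finset.sum_range_one,
        jacobiTrudi_one, Function.update_self, hshift, card_oneRow,
        ← factorial_mul_normalizedLaguerre, Nat.cast_sub (by omega : 1 ≤ n)]
      push_cast
      ring
    · rw [sum_borderStripRemovals_wronskianLaguerre α hN, sum_borderStripRemovals_two hneg hN,
        Finset.sum_range_one, jacobiTrudi_one, Function.update_self, hshift, card_oneRow,
        ← factorial_mul_normalizedLaguerre]
      obtain ⟨m, rfl⟩ : ∃ m, n = m + 2 := ⟨n - 2, by omega⟩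
      rw [show m + 2 - 1 = m + 1 by omega, show m + 2 - 2 = m by omega, Nat.factorial_succ]
      push_cast
      rw [add_sub_cancel_right]
      ring
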